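/- Let $K$ be a field and let $R=K[x_1,\dots,x_n]$ carry the standard grading. For an ideal $I$, $\mathrm{ass}(I)$ denotes the set of associated primes of $R/I$. The class of \emph{ass-decomposable} monomial ideals is defined recursively: a monomial ideal $I$ is ass-decomposable if either $I$ is primary, or there are a variable $x_i\notin\sqrt I$ and an integer $k\ge 1$ such that (a) $\mathrm{ass}(I,x_i^k)=\{\mathfrak p\in\mathrm{ass}(I) : x_i\in\mathfrak p\}$, and (b) both $(I,x_i^k)$ and $I:x_i^k$ are ass-decomposable. In the second case $x_i$ is called a \emph{decomposing variable} of $I$. Let $I\neq 0$ be a squarefree ass-decomposable monomial ideal, and let $I=\mathfrak p_1\cap\dots\cap\mathfrak p_r$ be its minimal (irredundant) prime decomposition; $r$ is the \emph{index of irreducibility} of $I$. Let $d(I)$ be the maximal degree of a minimal monomial generator of $I$, and let $\mathrm{reg}(R/I)=\sup\{j-i : \mathrm{Tor}_i^R(R/I,K)_j\ne 0\}$ be the Castelnuovo–Mumford regularity of $R/I$. Then $$\mathrm{reg}(R/I)=r-1\quad\Longleftrightarrow\quad d(I)=r .$$ Moreover, if these equivalent conditions hold and $x$ is a decomposing variable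 of $I$, then $I=\mathfrak p+xJ$ for some monomial prime ideal $\mathfrak p$ (possibly $0$) and some ass-decomposable monomial ideal $J$. -/

import Mathlib

open MvPolynomial

noncomputable section

/-! ### Monomial ideals of `K[x_1, …, x_n]` -/

/-- Ideals generated by a set of monomials. -/
def IsMonomialIdeal {K : Type*} [Field K] {n : ℕ} (I : Ideal (MvPolynomial (Fin n) K)) : Prop :=
  ∃ A : Set (Fin n →₀ ℕ), I = Ideal.span ((fun a => monomial a (1 : K)) '' A)

/-- Ideals generated by a set of squarefree monomials. -/
def IsSquarefreeMonomialIdeal {K : Type*} [Field K] {n : ℕ}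
    (I : Ideal (MvPolynomial (Fin n) K)) : Prop :=
  ∃ A : Set (Fin n →₀ ℕ), (∀ a ∈ A, ∀ v, a v ≤ 1) ∧
    I = Ideal.span ((fun a => monomial a (1 : K)) '' A)

/-- The set `G(I)` of minimal monomial generators of a monomial ideal (as exponent vectors):
the monomials of `I` that are minimal with respect to divisibility. -/
def minimalGenerators {K : Type*} [Field K] {n : ℕ} (I : Ideal (MvPolynomial (Fin n) K)) :
    Set (Fin n →₀ ℕ) :=
  {u | Minimal (fun a => monomial a (1 : K) ∈ I) u}

/-- `d(I) = d`: the number `d` is the maximum of the degrees of the minimal monomial generators. -/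
def IsMaxGeneratorDegree {K : Type*} [Field K] {n : ℕ} (I : Ideal (MvPolynomial (Fin n) K))
    (d : ℕ) : Prop :=
  IsGreatest (Finsupp.degree '' minimalGenerators I) d

/-- `I = p_1 ∩ … ∩ p_r` is a minimal (that is, irredundant) prime decomposition of `I`.
For a squarefree monomial ideal `I` the number `r` is its index of irreducibility. -/
structure IsMinimalPrimeDecomposition {R : Type*} [CommRing R] (I : Ideal R) {r : ℕ}
    (p : Fin r → Ideal R) : Prop where
  isPrime : ∀ i, (p i).IsPrime
  eq_iInf : I = ⨅ i, p i
  irredundant : ∀ i, ¬ (⨅ j : {j // j ≠ i}, p j) ≤ p i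

/-! ### Ass-decomposable ideals -/

/-- The ideal `(I, x_v ^ k)`. -/
def addPow {K : Type*} [Field K] {n : ℕ} (I : Ideal (MvPolynomial (Fin n) K)) (v : Fin n) (k : ℕ) :
    Ideal (MvPolynomial (Fin n) K) :=
  I ⊔ Ideal.span {X v ^ k}

/-- The ideal `I : x_v ^ k`. -/
def colonPow {K : Type*} [Field K] {n : ℕ} (I : Ideal (MvPolynomial (Fin n) K)) (v : Fin n)
    (k : ℕ) : Ideal (MvPolynomial (Fin n) K) :=
  Submodule.colon I {X v ^ k}

/-- The set `ass(I)` of associated primes of `R / I`. -/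
def ass {R : Type*} [CommRing R] (I : Ideal R) : Set (Ideal R) :=
  associatedPrimes R (R ⧸ I)

/-- Ass-decomposable monomial ideals. -/
inductive AssDecomposable {K : Type*} [Field K] {n : ℕ} : Ideal (MvPolynomial (Fin n) K) → Prop
  | primary (I : Ideal (MvPolynomial (Fin n) K)) (hI : IsMonomialIdeal I) (h : I.IsPrimary) :
      AssDecomposable I
  | step (I : Ideal (MvPolynomial (Fin n) K)) (hI : IsMonomialIdeal I) (v : Fin n) (k : ℕ)
      (hk : 0 < k) (hv : X v ∉ I.radical)
      (hass : ass (addPow I v k) = {p ∈ ass I | X v ∈ p})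
      (hadd : AssDecomposable (addPow I v k)) (hcolon : AssDecomposable (colonPow I v k)) :
      AssDecomposable I

/-- `x_v ^ k` is a decomposing monomial of `I`. -/
structure IsDecomposingMonomial {K : Type*} [Field K] {n : ℕ}
    (I : Ideal (MvPolynomial (Fin n) K)) (v : Fin n) (k : ℕ) : Prop where
  pos : 0 < k
  notMem_radical : X v ∉ I.radical
  ass_addPow : ass (addPow I v k) = {p ∈ ass I | X v ∈ p}
  addPow : AssDecomposable (addPow I v k)
  colonPow : AssDecomposable (colonPow I v k)

/-- `x_v` is a decomposing variable of `I`: one of its powers is a decomposing monomial. -/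
def IsDecomposingVariable {K : Type*} [Field K] {n : ℕ}
    (I : Ideal (MvPolynomial (Fin n) K)) (v : Fin n) : Prop :=
  ∃ k, IsDecomposingMonomial I v k

/-! ### Graded Tor and Castelnuovo–Mumford regularity

Let `R = K[x_1, …, x_n]`. The residue field `K = R / (x_1, …, x_n)` is resolved by the Koszul
complex `⋯ → ⋀² Rⁿ → Rⁿ → R`, in which the basis element `e_S` of `⋀ⁱ Rⁿ` (`S` a set of `i` indices)
has degree `i`, and `d e_S = ∑_{v ∈ S} (-1)^{#{u ∈ S | u < v}} x_v e_{S ∖ v}`.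
For an `R`-module `M`, an element `∑ c_S ⊗ e_S` of the tensor product of `M` with the (total) Koszul
complex is represented by the function `S ↦ c_S`. -/

/-- The sign `(-1)^{#{u ∈ T | u < v}}`, as an integer. -/
def koszulSign {n : ℕ} (v : Fin n) (T : Finset (Fin n)) : ℤ :=
  (-1) ^ (T.filter (· < v)).card

/-- The differential of `M ⊗ (Koszul complex)`. -/
def koszulD (K : Type*) [Field K] {n : ℕ} (M : Type*) [AddCommGroup M]
    [Module (MvPolynomial (Fin n) K) M] :
    (Finset (Fin n) → M) →ₗ[MvPolynomial (Fin n) K] (Finset (Fin n) → M) where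
  toFun c T := ∑ v ∈ Tᶜ, koszulSign v T • (X v : MvPolynomial (Fin n) K) • c (insert v T)
  map_add' c c' := by
    funext T
    simp only [Pi.add_apply, smul_add, Finset.sum_add_distrib]
  map_smul' a c := by
    funext T
    simp only [Pi.smul_apply, RingHom.id_apply, Finset.smul_sum]
    refine Finset.sum_congr rfl fun v _ => ?_
    rw [smul_comm a (koszulSign v T), smul_comm a (X v : MvPolynomial (Fin n) K)]

theorem koszulD_apply {K : Type*} [Field K] {n : ℕ} {M : Type*} [AddCommGroup M]
    [Module (MvPolynomial (Fin n) K) M] (c : Finset (Fin n) → M) (T : Finset (Fin n)) :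
    koszulD K M c T =
      ∑ v ∈ Tᶜ, koszulSign v T • (X v : MvPolynomial (Fin n) K) • c (insert v T) := rfl

theorem koszulSign_insert_of_lt {n : ℕ} {u v : Fin n} {T : Finset (Fin n)} (hu : u ∉ T)
    (h : u < v) : koszulSign v (insert u T) = - koszulSign v T := by
  unfold koszulSign
  rw [Finset.filter_insert, if_pos h, Finset.card_insert_of_notMem (by simp [hu]), pow_succ]
  ring

theorem koszulSign_insert_of_not_lt {n : ℕ} {u v : Fin n} {T : Finset (Fin n)}
    (h : ¬ u < v) : koszulSign v (insert u T) = koszulSign v T := by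
  unfold koszulSign
  rw [Finset.filter_insert, if_neg h]

theorem koszulSign_swap {n : ℕ} {u v : Fin n} {T : Finset (Fin n)} (hu : u ∉ T) (hv : v ∉ T)
    (h : u ≠ v) : koszulSign u T * koszulSign v (insert u T) =
      - (koszulSign v T * koszulSign u (insert v T)) := by
  rcases lt_or_gt_of_ne h with h | h
  · rw [koszulSign_insert_of_lt hu h, koszulSign_insert_of_not_lt h.not_gt]; ring
  · rw [koszulSign_insert_of_lt hv h, koszulSign_insert_of_not_lt h.not_gt]; ring

/-- The Koszul differential squares to zero. -/
theorem koszulD_koszulD {K : Type*} [Field K] {n : ℕ} {M : Type*} [AddCommGroup M]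
    [Module (MvPolynomial (Fin n) K) M] (c : Finset (Fin n) → M) :
    koszulD K M (koszulD K M c) = 0 := by
  funext T
  simp only [koszulD_apply, Finset.smul_sum, Pi.zero_apply]
  rw [Finset.sum_sigma']
  refine Finset.sum_involution (fun a _ => ⟨a.2, a.1⟩) ?_ ?_ ?_ ?_
  · rintro ⟨u, v⟩ h
    simp only [Finset.mem_sigma, Finset.mem_compl, Finset.mem_insert, not_or] at h
    obtain ⟨hu, hvu, hv⟩ := h
    simp only
    rw [Finset.insert_comm v u]
    simp only [smul_comm (X u : MvPolynomial (Fin n) K) (koszulSign _ _ : ℤ),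
      smul_comm (X v : MvPolynomial (Fin n) K) (koszulSign _ _ : ℤ), smul_smul]
    rw [mul_comm (X v : MvPolynomial (Fin n) K) (X u), ← add_smul,
      koszulSign_swap hu hv (Ne.symm hvu), neg_add_cancel, zero_smul]
  · rintro ⟨u, v⟩ h _ he
    simp only [Finset.mem_sigma, Finset.mem_compl, Finset.mem_insert, not_or] at h
    simp only [Sigma.mk.injEq, heq_eq_eq] at he
    exact h.2.1 he.1
  · rintro ⟨u, v⟩ h
    simp only [Finset.mem_sigma, Finset.mem_compl, Finset.mem_insert, not_or] at h ⊢
    exact ⟨h.2.2, Ne.symm h.2.1, h.1⟩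
  · rintro ⟨u, v⟩ _
    rfl

/-- The contracting homotopy of the Koszul complex of `R` in nonzero multidegrees: on basis elements,
`x^b e_S ↦ x^(b - δ_v) e_(S ∪ {v})` if the least element `v` of `supp b ∪ S` is not in `S`, and
`x^b e_S ↦ 0` otherwise. -/
def koszulHomotopy {K : Type*} [Field K] {n : ℕ} (c : Finset (Fin n) → MvPolynomial (Fin n) K)
    (T : Finset (Fin n)) : MvPolynomial (Fin n) K :=
  if h : T.Nonempty then
    ∑ b ∈ ((c (T.erase (T.min' h))).divMonomial (Finsupp.single (T.min' h) 1)).support with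
        ∀ u, b u ≠ 0 → T.min' h ≤ u,
      monomial b (coeff (Finsupp.single (T.min' h) 1 + b) (c (T.erase (T.min' h))))
  else 0

theorem coeff_koszulHomotopy {K : Type*} [Field K] {n : ℕ}
    (c : Finset (Fin n) → MvPolynomial (Fin n) K) {T : Finset (Fin n)} {v : Fin n} (hv : v ∈ T)
    (hmin : ∀ u ∈ T, v ≤ u) (b : Fin n →₀ ℕ) :
    coeff b (koszulHomotopy c T) =
      if ∀ u, b u ≠ 0 → v ≤ u then coeff (Finsupp.single v 1 + b) (c (T.erase v)) else 0 := by
  have h : T.Nonempty := ⟨v, hv⟩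
  have hm : T.min' h = v := le_antisymm (T.min'_le v hv) (hmin _ (T.min'_mem h))
  unfold koszulHomotopy
  rw [dif_pos h, hm, coeff_sum]
  simp only [coeff_monomial]
  rw [Finset.sum_ite_eq']
  by_cases h1 : ∀ u, b u ≠ 0 → v ≤ u
  · by_cases h2 : coeff (Finsupp.single v 1 + b) (c (T.erase v)) = 0
    · simp [h2]
    · rw [if_pos h1, if_pos (Finset.mem_filter.2
        ⟨mem_support_iff.2 (by rwa [coeff_divMonomial]), h1⟩)]
  · rw [if_neg h1, if_neg fun h => h1 (Finset.mem_filter.1 h).2]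

theorem coeff_koszulD {K : Type*} [Field K] {n : ℕ}
    (c : Finset (Fin n) → MvPolynomial (Fin n) K) (T : Finset (Fin n)) (b : Fin n →₀ ℕ) :
    coeff b (koszulD K _ c T) = ∑ v ∈ Tᶜ, koszulSign v T •
      (if b v ≠ 0 then coeff (b - Finsupp.single v 1) (c (insert v T)) else 0) := by
  rw [koszulD_apply, coeff_sum]
  refine Finset.sum_congr rfl fun v _ => ?_
  rw [coeff_smul, smul_eq_mul, coeff_X_mul']
  simp only [Finsupp.mem_support_iff]

/-- The Koszul complex of `R` is exact in positive homological degrees, and the image of the last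
differential is the ideal `(x_1, …, x_n)`: it is a free resolution of `K`. -/
theorem koszul_exact {K : Type*} [Field K] {n : ℕ} (c : Finset (Fin n) → MvPolynomial (Fin n) K)
    (i : ℕ) (hc : ∀ S, S.card ≠ i → c S = 0) (hd : koszulD K _ c = 0)
    (h0 : coeff 0 (c ∅) = 0) :
    ∃ b : Finset (Fin n) → MvPolynomial (Fin n) K,
      (∀ S, S.card ≠ i + 1 → b S = 0) ∧ koszulD K _ b = c := by
  refine ⟨koszulHomotopy c, fun S hS => ?_, ?_⟩
  · unfold koszulHomotopy
    split_ifs with h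
    · have : c (S.erase (S.min' h)) = 0 := by
        apply hc
        rw [Finset.card_erase_of_mem (S.min'_mem h)]
        have := h.card_pos
        omega
      rw [this]
      simp
    · rfl
  funext T
  ext b
  rw [coeff_koszulD]
  have key : ∀ v : Fin n, (∀ u ∈ T, v < u) → (∀ u, b u ≠ 0 → v ≤ u) → b v ≠ 0 →
      koszulSign v T • (if b v ≠ 0 then coeff (b - Finsupp.single v 1)
        (koszulHomotopy c (insert v T)) else 0) = coeff b (c T) := by
    intro v hT hb hv
    have hvT : v ∉ T := fun h => lt_irrefl _ (hT v h)
    rw [if_pos hv, coeff_koszulHomotopy c (Finset.mem_insert_self v T)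
      (by simpa using fun u hu => (hT u hu).le), if_pos, Finset.erase_insert hvT,
      add_tsub_cancel_of_le (Finsupp.single_le_iff.2 (Nat.one_le_iff_ne_zero.2 hv))]
    · have : T.filter (· < v) = ∅ :=
        Finset.filter_eq_empty_iff.2 fun u hu => (hT u hu).not_gt
      simp [koszulSign, this]
    · intro u hu
      refine hb u fun h => hu ?_
      simp [h]
  by_cases hne : (T ∪ b.support).Nonempty
  swap
  · rw [Finset.not_nonempty_iff_eq_empty, Finset.union_eq_empty, Finsupp.support_eq_empty] at hne
    obtain ⟨rfl, rfl⟩ := hne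
    simp [h0]
  obtain ⟨v, hv, hmin⟩ : ∃ v ∈ T ∪ b.support, ∀ u ∈ T ∪ b.support, v ≤ u :=
    ⟨_, Finset.min'_mem _ hne, fun u hu => Finset.min'_le _ u hu⟩
  have hminT : ∀ u ∈ T, v ≤ u := fun u hu => hmin u (Finset.mem_union_left _ hu)
  have hminb : ∀ u, b u ≠ 0 → v ≤ u := fun u hu =>
    hmin u (Finset.mem_union_right _ (Finsupp.mem_support_iff.2 hu))
  by_cases hvT : v ∈ T
  · -- the least index lies in `T`: use that `d c` vanishes at `T ∖ {v}`
    have hz : coeff (Finsupp.single v 1 + b) (koszulD K _ c (T.erase v)) = 0 := by simp [hd]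
    have hC : (T.erase v)ᶜ = insert v Tᶜ := by
      ext u; by_cases hu : u = v <;> simp [hu]
    rw [coeff_koszulD, hC, Finset.sum_insert (by simpa using hvT), Finset.insert_erase hvT,
      add_tsub_cancel_left, if_pos (by simp)] at hz
    have hs : koszulSign v (T.erase v) = 1 := by
      have : (T.erase v).filter (· < v) = ∅ := Finset.filter_eq_empty_iff.2 fun u hu =>
        (hminT u (Finset.mem_of_mem_erase hu)).not_gt
      simp [koszulSign, this]
    rw [hs, one_smul] at hz
    rw [eq_neg_of_add_eq_zero_left hz, ← Finset.sum_neg_distrib]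
    refine Finset.sum_congr rfl fun w hw => ?_
    have hwT : w ∉ T := by simpa using hw
    have hwv : w ≠ v := fun h => hwT (h ▸ hvT)
    by_cases hbw : b w = 0
    · simp [hbw, Ne.symm hwv]
    · have hlt : v < w := lt_of_le_of_ne (hminb w hbw) (Ne.symm hwv)
      have hsg : koszulSign w T = - koszulSign w (T.erase v) := by
        conv_lhs => rw [← Finset.insert_erase hvT]
        exact koszulSign_insert_of_lt (Finset.notMem_erase v T) hlt
      rw [if_pos hbw, if_pos (by simp [hbw]), coeff_koszulHomotopy c
        (Finset.mem_insert_of_mem hvT) (by simpa using ⟨hlt.le, hminT⟩), if_pos, hsg, neg_smul,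
        Finset.erase_insert_of_ne hwv,
        add_tsub_assoc_of_le (Finsupp.single_le_iff.2 (Nat.one_le_iff_ne_zero.2 hbw))]
      intro u hu
      refine hminb u fun h => hu ?_
      simp [h]
  · have hbv : b v ≠ 0 := by
      simpa [hvT] using hv
    have hT : ∀ u ∈ T, v < u := fun u hu =>
      lt_of_le_of_ne (hminT u hu) fun h => hvT (h ▸ hu)
    rw [Finset.sum_eq_single v, key v hT hminb hbv]
    · intro w hw hwv
      by_cases hbw : b w = 0
      · simp [hbw]
      · have hne' : (insert w T).Nonempty := Finset.insert_nonempty _ _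
        rw [if_pos hbw, coeff_koszulHomotopy c (Finset.min'_mem _ hne')
          (fun u hu => Finset.min'_le _ u hu), if_neg, smul_zero]
        intro h
        have h1 := h v (by simpa [Finsupp.single_apply, hwv] using hbv)
        have h2 := Finset.min'_mem _ hne'
        rcases Finset.mem_insert.1 h2 with h3 | h3
        · rw [h3] at h1
          exact hwv (le_antisymm h1 (hminb w hbw))
        · exact absurd h1 (hT _ h3).not_ge
    · intro h
      simp [hvT] at h

/-- The part of internal degree `j` of `M ⊗ ⋀ⁱ Rⁿ`, where `M` is graded by the pieces `ℳ d`: as `e_S`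
has degree `i`, the coefficient of `e_S` has degree `j - i` (so it vanishes if `j < i`). -/
def koszulPiece {K : Type*} [Field K] (n : ℕ) {M : Type*} [AddCommGroup M] [Module K M]
    (ℳ : ℕ → Submodule K M) (i j : ℕ) : Submodule K (Finset (Fin n) → M) :=
  Submodule.pi Set.univ fun S => if S.card = i ∧ i ≤ j then ℳ (j - i) else ⊥

/-- The cycles in `(M ⊗ ⋀ⁱ Rⁿ)_j`. -/
def koszulCycles {K : Type*} [Field K] (n : ℕ) {M : Type*} [AddCommGroup M] [Module K M]
    [Module (MvPolynomial (Fin n) K) M] [IsScalarTower K (MvPolynomial (Fin n) K) M]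
    (ℳ : ℕ → Submodule K M) (i j : ℕ) : Submodule K (Finset (Fin n) → M) :=
  koszulPiece n ℳ i j ⊓ LinearMap.ker ((koszulD K (n := n) M).restrictScalars K)

/-- The boundaries in `(M ⊗ ⋀ⁱ Rⁿ)_j`: the image of `(M ⊗ ⋀ⁱ⁺¹ Rⁿ)_j`. -/
def koszulBoundaries {K : Type*} [Field K] (n : ℕ) {M : Type*} [AddCommGroup M] [Module K M]
    [Module (MvPolynomial (Fin n) K) M] [IsScalarTower K (MvPolynomial (Fin n) K) M]
    (ℳ : ℕ → Submodule K M) (i j : ℕ) : Submodule K (Finset (Fin n) → M) :=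
  (koszulPiece n ℳ (i + 1) j).map ((koszulD K (n := n) M).restrictScalars K)

/-- For a graded module, boundaries are cycles. -/
theorem koszulBoundaries_le_koszulCycles {K : Type*} [Field K] (n : ℕ) {M : Type*}
    [AddCommGroup M] [Module K M] [Module (MvPolynomial (Fin n) K) M]
    [IsScalarTower K (MvPolynomial (Fin n) K) M] (ℳ : ℕ → Submodule K M)
    (hℳ : ∀ d v, ∀ a ∈ ℳ d, (X v : MvPolynomial (Fin n) K) • a ∈ ℳ (d + 1)) (i j : ℕ) :
    koszulBoundaries n ℳ i j ≤ koszulCycles n ℳ i j := by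
  rintro _ ⟨c, hc, rfl⟩
  refine ⟨?_, koszulD_koszulD c⟩
  intro T _
  refine Submodule.sum_mem _ fun v hv => ?_
  rw [← Int.cast_smul_eq_zsmul K]
  refine Submodule.smul_mem _ _ ?_
  have h := hc (insert v T) trivial
  simp only [Finset.card_insert_of_notMem (Finset.mem_compl.1 hv), Nat.add_right_cancel_iff] at h
  split_ifs at h with h1
  · have h2 : j - i = j - (i + 1) + 1 := by omega
    simp only
    rw [if_pos (And.intro h1.1 (by omega : i ≤ j)), h2]
    exact hℳ _ _ _ h
  · rw [(Submodule.mem_bot K).1 h, smul_zero]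
    exact Submodule.zero_mem _

/-- The graded piece `Tor_i^R(M, K)_j` for a graded module `M = ⨁_d ℳ d` over
`R = K[x_1, …, x_n]`. Its dimension over `K` is the graded Betti number `β_{i,j}(M)`. -/
abbrev GradedTor {K : Type*} [Field K] (n : ℕ) {M : Type*} [AddCommGroup M] [Module K M]
    [Module (MvPolynomial (Fin n) K) M] [IsScalarTower K (MvPolynomial (Fin n) K) M]
    (ℳ : ℕ → Submodule K M) (i j : ℕ) : Type _ :=
  koszulCycles n ℳ i j ⧸ (koszulBoundaries n ℳ i j).submoduleOf (koszulCycles n ℳ i j)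

/-- `reg(M) = m`: the integer `m` is the supremum of the numbers `j - i` with `β_{i,j}(M) ≠ 0`. -/
def HasRegularity {K : Type*} [Field K] (n : ℕ) {M : Type*} [AddCommGroup M] [Module K M]
    [Module (MvPolynomial (Fin n) K) M] [IsScalarTower K (MvPolynomial (Fin n) K) M]
    (ℳ : ℕ → Submodule K M) (m : ℤ) : Prop :=
  IsLUB {s : ℤ | ∃ i j : ℕ, Nontrivial (GradedTor n ℳ i j) ∧ s = (j : ℤ) - i} m

/-- The standard grading of `R / I`: the piece of degree `d` consists of the classes of the
homogeneous polynomials of degree `d`. -/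
def quotientGrading {K : Type*} [Field K] {n : ℕ} (I : Ideal (MvPolynomial (Fin n) K)) (d : ℕ) :
    Submodule K (MvPolynomial (Fin n) K ⧸ I) :=
  (homogeneousSubmodule (Fin n) K d).map (Ideal.Quotient.mkₐ K I).toLinearMap

end

/-! The components of `I` are generated by variables, so `I` becomes `coverIdeal K F` for an
antichain `F` of `r` sets of indices, and its monomials are those whose support meets every member
of `F`. In these terms `(I, x_v)` is given by inserting `v` into every member, and `I : x_v ^ k` by
keeping the members that miss `v`. Condition (a) says that `(I, x_v)` is the intersection of just
those components that contain `x_v` (`coverIdeal_image_insert_eq`); let `s` be their number.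

Multiplication by `x_v` gives the exact sequence `Tor_i(R/(I : x_v))_(j-1) → Tor_i(R/I)_j →
Tor_i(R/(I, x_v))_j`, made explicit on Koszul chains in `torVanishes_of_colon`. Induction along it
bounds the regularity by `r - 1` for every intersection of `r` monomial primes (`regLE_coverIdeal`).
A minimal generator of degree `r` gives a class in `Tor_1` of degree `r`, so the bound is attained.

Conversely, let the bound be attained (`exists_minimal_of_not_torVanishes`). As `1 ≤ s < r`, the
term of `(I, x_v)` vanishes, hence that of `I : x_v` does not; its bound `r - s - 1` then forces `s
= 1`. By induction `I : x_v` has a minimal generator of degree `r - 1`, and `x_v` times a suitable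
such generator is one of `I`.

For the last claim, a minimal generator of degree `r` forces `s = 1` for every decomposing variable,
so `(I, x_v)` is generated by variables and `I` splits (`coverIdeal_eq_sup`). -/

/-- The monomial prime ideal generated by the variables `x_v` with `v ∈ A`. -/
noncomputable def varIdeal (K : Type*) [Field K] {n : ℕ} (A : Finset (Fin n)) : Ideal (MvPolynomial (Fin n) K) :=
  Ideal.span (X '' (A : Set (Fin n)))

/-- The intersection of the monomial prime ideals `varIdeal K A` for `A ∈ F`. -/
noncomputable def coverIdeal (K : Type*) [Field K] {n : ℕ} (F : Finset (Finset (Fin n))) :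
    Ideal (MvPolynomial (Fin n) K) :=
  F.inf (varIdeal K)

/-- The support of the exponent vector `m` meets every member of `F`. -/
def IsCover {n : ℕ} (F : Finset (Finset (Fin n))) (m : Fin n →₀ ℕ) : Prop :=
  ∀ A ∈ F, ∃ u ∈ A, m u ≠ 0

/-! ### Intersections of monomial primes, their colons and sums -/

section Ideals

variable {K : Type*} [Field K] {n : ℕ}

theorem mem_varIdeal {A : Finset (Fin n)} {f : MvPolynomial (Fin n) K} :
    f ∈ varIdeal K A ↔ ∀ m ∈ f.support, ∃ u ∈ A, m u ≠ 0 := by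
  simp [varIdeal, mem_ideal_span_X_image]

theorem mem_coverIdeal {F : Finset (Finset (Fin n))} {f : MvPolynomial (Fin n) K} :
    f ∈ coverIdeal K F ↔ ∀ m ∈ f.support, IsCover F m := by
  simp only [coverIdeal, Submodule.mem_finsetInf, mem_varIdeal, IsCover]
  exact ⟨fun h m hm A hA => h A hA m hm, fun h A hA m hm => h m hm A hA⟩

theorem monomial_mem_coverIdeal {F : Finset (Finset (Fin n))} {m : Fin n →₀ ℕ} :
    monomial m (1 : K) ∈ coverIdeal K F ↔ IsCover F m := by
  classical
  rw [mem_coverIdeal, support_monomial, if_neg one_ne_zero]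
  simp

theorem X_mem_varIdeal {A : Finset (Fin n)} {v : Fin n} :
    (X v : MvPolynomial (Fin n) K) ∈ varIdeal K A ↔ v ∈ A := by
  rw [mem_varIdeal, support_X]
  simp [Finsupp.single_apply]

theorem varIdeal_le_varIdeal {A B : Finset (Fin n)} :
    varIdeal K A ≤ varIdeal K B ↔ A ⊆ B := by
  refine ⟨fun h v hv => X_mem_varIdeal.1 (h (X_mem_varIdeal.2 hv)), fun h => ?_⟩
  exact Ideal.span_mono (Set.image_mono (by exact_mod_cast h))

/-- The ideal is the kernel of the endomorphism that kills the variables in `A`, whose target is a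
domain. -/
theorem varIdeal_isPrime (A : Finset (Fin n)) : (varIdeal K A).IsPrime := by
  classical
  let φ : MvPolynomial (Fin n) K →ₐ[K] MvPolynomial (Fin n) K :=
    aeval fun v => if v ∈ A then 0 else X v
  have hφ : (Ideal.Quotient.mkₐ K (varIdeal K A)).comp φ = Ideal.Quotient.mkₐ K (varIdeal K A) := by
    refine algHom_ext fun v => ?_
    by_cases hv : v ∈ A
    · have : Ideal.Quotient.mk (varIdeal K A) (X v) = 0 :=
        Ideal.Quotient.eq_zero_iff_mem.2 (X_mem_varIdeal.2 hv)
      simp [φ, hv, this]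
    · simp [φ, hv]
  have : varIdeal K A = RingHom.ker φ := by
    refine le_antisymm (Ideal.span_le.2 ?_) fun f hf => ?_
    · rintro _ ⟨v, hv, rfl⟩
      have : v ∈ A := hv
      simp [φ, this]
    · have h := DFunLike.congr_fun hφ f
      rw [RingHom.mem_ker] at hf
      simp only [AlgHom.comp_apply, hf, map_zero] at h
      exact Ideal.Quotient.eq_zero_iff_mem.1 h.symm
  rw [this]
  exact RingHom.ker_isPrime _

theorem coverIdeal_radical (F : Finset (Finset (Fin n))) :
    (coverIdeal K F).radical = coverIdeal K F := by
  refine le_antisymm (fun f hf => ?_) Ideal.le_radical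
  obtain ⟨k, hk⟩ := hf
  rw [coverIdeal, Submodule.mem_finsetInf] at hk ⊢
  exact fun A hA => (varIdeal_isPrime A).mem_of_pow_mem k (hk A hA)

theorem coverIdeal_singleton (A : Finset (Fin n)) : coverIdeal K {A} = varIdeal K A := by
  simp [coverIdeal]

/-- A monomial `x^m` with `m_v = 0` lies in `(I, x_v)` if and only if it lies in `I`. -/
theorem isCover_image_insert {F : Finset (Finset (Fin n))} {v : Fin n} {m : Fin n →₀ ℕ}
    (hm : m v = 0) : IsCover (F.image (insert v)) m ↔ IsCover F m := by
  simp [IsCover, hm]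

theorem isCover_of_ne_zero {F : Finset (Finset (Fin n))} {v : Fin n} {m : Fin n →₀ ℕ}
    (hm : m v ≠ 0) : IsCover (F.image (insert v)) m := by
  simp [IsCover, hm]

/-- A factor `x_v ^ k` takes care of exactly the members containing `v`. The exponent plays no role,
so decomposing powers can be replaced by the variable itself. -/
theorem isCover_filter_notMem {F : Finset (Finset (Fin n))} {v : Fin n} {m : Fin n →₀ ℕ}
    {k : ℕ} (hk : k ≠ 0) :
    IsCover (F.filter (v ∉ ·)) m ↔ IsCover F (m + Finsupp.single v k) := by
  refine ⟨fun h A hA => ?_, fun h A hA => ?_⟩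
  · by_cases hv : v ∈ A
    · exact ⟨v, hv, by simp [hk]⟩
    · obtain ⟨u, hu, hmu⟩ := h A (Finset.mem_filter.2 ⟨hA, hv⟩)
      exact ⟨u, hu, by simp [hmu]⟩
  · obtain ⟨hA, hv⟩ := Finset.mem_filter.1 hA
    obtain ⟨u, hu, hmu⟩ := h A hA
    have : v ≠ u := fun h => hv (h ▸ hu)
    exact ⟨u, hu, by simpa [Finsupp.single_apply, this] using hmu⟩

theorem mem_coverIdeal_filter_notMem {F : Finset (Finset (Fin n))} {v : Fin n}
    {f : MvPolynomial (Fin n) K} {k : ℕ} (hk : k ≠ 0) :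
    f ∈ coverIdeal K (F.filter (v ∉ ·)) ↔ f * X v ^ k ∈ coverIdeal K F := by
  simp only [mem_coverIdeal, isCover_filter_notMem hk]
  have : (X v : MvPolynomial (Fin n) K) ^ k = monomial (Finsupp.single v k) 1 := by
    rw [X_pow_eq_monomial]
  rw [this]
  refine ⟨fun h m hm => ?_, fun h m hm => ?_⟩
  · rw [mem_support_iff, coeff_mul_monomial'] at hm
    split_ifs at hm with h1
    · have := h _ (mem_support_iff.2 (by simpa using hm))
      rwa [tsub_add_cancel_of_le h1] at this
    · exact absurd rfl hm
  · refine h _ (mem_support_iff.2 ?_)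
    rw [coeff_mul_monomial, mul_one]
    exact mem_support_iff.1 hm

theorem colonPow_coverIdeal (F : Finset (Finset (Fin n))) (v : Fin n) {k : ℕ} (hk : k ≠ 0) :
    colonPow (coverIdeal K F) v k = coverIdeal K (F.filter (v ∉ ·)) := by
  ext f
  rw [colonPow, Submodule.mem_colon_singleton, smul_eq_mul, mem_coverIdeal_filter_notMem hk]

theorem X_mem_coverIdeal_image_insert (F : Finset (Finset (Fin n))) (v : Fin n) :
    (X v : MvPolynomial (Fin n) K) ∈ coverIdeal K (F.image (insert v)) :=
  monomial_mem_coverIdeal.2 (isCover_of_ne_zero (by simp))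

theorem coverIdeal_le_image_insert (F : Finset (Finset (Fin n))) (v : Fin n) :
    coverIdeal K F ≤ coverIdeal K (F.image (insert v)) := by
  intro f hf
  rw [mem_coverIdeal] at hf ⊢
  intro m hm
  by_cases h : m v = 0
  · exact (isCover_image_insert h).2 (hf m hm)
  · exact isCover_of_ne_zero h

/-- Division by `x_v` with remainder, for an element of `(I, x_v)`. -/
theorem sub_X_mul_divMonomial_mem {F : Finset (Finset (Fin n))} {v : Fin n}
    {f : MvPolynomial (Fin n) K} (hf : f ∈ coverIdeal K (F.image (insert v))) :
    f - X v * f.divMonomial (Finsupp.single v 1) ∈ coverIdeal K F := by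
  have h1 : f - X v * f.divMonomial (Finsupp.single v 1) = f.modMonomial (Finsupp.single v 1) := by
    rw [sub_eq_iff_eq_add']
    exact (divMonomial_add_modMonomial f _).symm
  rw [h1, mem_coverIdeal]
  intro m hm
  rw [mem_support_iff] at hm
  have h2 : ¬ Finsupp.single v 1 ≤ m := fun h => hm (coeff_modMonomial_of_le _ h)
  rw [coeff_modMonomial_of_not_le _ h2] at hm
  exact (isCover_image_insert (by simpa [Finsupp.single_le_iff] using h2)).1
    (mem_coverIdeal.1 hf m (mem_support_iff.2 hm))

theorem addPow_coverIdeal_le (F : Finset (Finset (Fin n))) (v : Fin n) {k : ℕ} (hk : k ≠ 0) :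
    addPow (coverIdeal K F) v k ≤ coverIdeal K (F.image (insert v)) := by
  refine sup_le (coverIdeal_le_image_insert F v) ((Ideal.span_singleton_le_iff_mem _).2 ?_)
  exact Ideal.pow_mem_of_mem _ (X_mem_coverIdeal_image_insert F v) k (Nat.pos_of_ne_zero hk)

/-- An associated prime has the form `I : f`, which is the intersection of the components not
containing `f`; a prime that is a finite intersection equals one of the terms. -/
theorem exists_eq_varIdeal_of_mem_ass {F : Finset (Finset (Fin n))}
    {p : Ideal (MvPolynomial (Fin n) K)} (hp : p ∈ ass (coverIdeal K F)) :
    ∃ A ∈ F, p = varIdeal K A := by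
  obtain ⟨hpp, x, hx⟩ := isAssociatedPrime_iff.1 hp
  obtain ⟨f, rfl⟩ := Ideal.Quotient.mk_surjective x
  have hmem : ∀ g, g ∈ p ↔ g * f ∈ coverIdeal K F := fun g => by
    rw [hx, Submodule.mem_colon_singleton, Submodule.mem_bot, ← Ideal.Quotient.eq_zero_iff_mem,
      map_mul]
    rfl
  classical
  have hinf : p = (F.filter (f ∉ varIdeal K ·)).inf (varIdeal K) := by
    ext g
    rw [hmem, coverIdeal, Submodule.mem_finsetInf, Submodule.mem_finsetInf]
    refine ⟨fun h A hA => ?_, fun h A hA => ?_⟩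
    · obtain ⟨hA, hf⟩ := Finset.mem_filter.1 hA
      exact ((varIdeal_isPrime A).mem_or_mem (h A hA)).resolve_right hf
    · by_cases hf : f ∈ varIdeal K A
      · exact Ideal.mul_mem_left _ _ hf
      · exact Ideal.mul_mem_right _ _ (h A (Finset.mem_filter.2 ⟨hA, hf⟩))
  obtain ⟨A, hA, hle⟩ := hpp.inf_le'.1 hinf.ge
  exact ⟨A, (Finset.mem_filter.1 hA).1, le_antisymm (hinf.le.trans (Finset.inf_le hA)) hle⟩

theorem mem_radical_of_forall_mem_ass {R : Type*} [CommRing R] [IsNoetherianRing R] {I : Ideal R}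
    {f : R} (h : ∀ p ∈ ass I, f ∈ p) : f ∈ I.radical := by
  rw [← Ideal.sInf_minimalPrimes, Ideal.mem_sInf]
  intro p hp
  refine h p (Module.associatedPrimes.minimalPrimes_annihilator_subset_associatedPrimes R (R ⧸ I) ?_)
  rwa [Ideal.annihilator_quotient]

/-- If `ass (I, x_v^k)` consists of the associated primes of `I` that contain `x_v`, then `(I, x_v)`
is the intersection of these primes. -/
theorem coverIdeal_image_insert_eq {F : Finset (Finset (Fin n))} {v : Fin n} {k : ℕ} (hk : k ≠ 0)
    (hass : ass (addPow (coverIdeal K F) v k) = {p ∈ ass (coverIdeal K F) | X v ∈ p}) :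
    coverIdeal K (F.image (insert v)) = coverIdeal K (F.filter (v ∈ ·)) := by
  apply le_antisymm
  · intro f hf
    rw [mem_coverIdeal] at hf ⊢
    intro m hm A hA
    obtain ⟨hA, hv⟩ := Finset.mem_filter.1 hA
    have := hf m hm _ (Finset.mem_image_of_mem _ hA)
    rwa [Finset.insert_eq_of_mem hv] at this
  · intro f hf
    -- The larger ideal is radical and contains `(I, x_v^k)`, so it suffices that `f` lies in every
    -- associated prime of the latter.
    rw [← coverIdeal_radical]
    refine Ideal.radical_mono (addPow_coverIdeal_le F v hk) (mem_radical_of_forall_mem_ass ?_)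
    intro p hp
    rw [hass] at hp
    obtain ⟨A, hA, rfl⟩ := exists_eq_varIdeal_of_mem_ass hp.1
    exact (Finset.inf_le (f := varIdeal K)
      (Finset.mem_filter.2 ⟨hA, X_mem_varIdeal.1 hp.2⟩) : coverIdeal K _ ≤ _) hf

theorem isCover_image_insert_iff {F : Finset (Finset (Fin n))} {v : Fin n} {k : ℕ} (hk : k ≠ 0)
    (hass : ass (addPow (coverIdeal K F) v k) = {p ∈ ass (coverIdeal K F) | X v ∈ p})
    (m : Fin n →₀ ℕ) : IsCover (F.image (insert v)) m ↔ IsCover (F.filter (v ∈ ·)) m := by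
  rw [← monomial_mem_coverIdeal (K := K), coverIdeal_image_insert_eq hk hass,
    monomial_mem_coverIdeal]

theorem minimalGenerators_coverIdeal (F : Finset (Finset (Fin n))) :
    minimalGenerators (coverIdeal K F) = {u | Minimal (IsCover F) u} := by
  ext u
  have : (fun a => monomial a (1 : K) ∈ coverIdeal K F) = IsCover F :=
    funext fun a => propext monomial_mem_coverIdeal
  simp only [minimalGenerators, this]

theorem AssDecomposable.isMonomialIdeal {I : Ideal (MvPolynomial (Fin n) K)}
    (h : AssDecomposable I) : IsMonomialIdeal I := by
  cases h <;> assumption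

theorem AssDecomposable.ne_top {I : Ideal (MvPolynomial (Fin n) K)}
    (h : AssDecomposable I) : I ≠ ⊤ := by
  cases h with
  | primary _ _ h => exact h.1
  | step _ _ v k _ hv => exact fun h => hv (h ▸ Ideal.le_radical (Submodule.mem_top))

theorem isMonomialIdeal_varIdeal (A : Finset (Fin n)) : IsMonomialIdeal (varIdeal K A) := by
  refine ⟨(fun v => Finsupp.single v 1) '' (A : Set (Fin n)), ?_⟩
  rw [Set.image_image]
  rfl

/-- The members of an irredundant prime decomposition of a monomial ideal are generated by
variables. -/
theorem exists_coverIdeal_of_isMinimalPrimeDecomposition {I : Ideal (MvPolynomial (Fin n) K)}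
    (hI : IsMonomialIdeal I) {r : ℕ} {P : Fin r → Ideal (MvPolynomial (Fin n) K)}
    (hP : IsMinimalPrimeDecomposition I P) :
    ∃ F : Finset (Finset (Fin n)), I = coverIdeal K F ∧ F.card = r ∧
      IsAntichain (· ⊆ ·) (F : Set (Finset (Fin n))) := by
  classical
  obtain ⟨S, rfl⟩ := hI
  have hanti : ∀ i j, P i ≤ P j → i = j := by
    intro i j hij
    by_contra hne
    exact hP.irredundant j ((iInf_le (fun k : {k // k ≠ j} => P k) ⟨i, hne⟩).trans hij)
  have hvar : ∀ i, ∃ A : Finset (Fin n), P i = varIdeal K A := by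
    intro i
    set A : Finset (Fin n) := Finset.univ.filter fun v => (X v : MvPolynomial (Fin n) K) ∈ P i
    have hA : varIdeal K A ≤ P i := by
      refine Ideal.span_le.2 ?_
      rintro _ ⟨v, hv, rfl⟩
      exact (Finset.mem_filter.1 (Finset.mem_coe.1 hv)).2
    -- Each monomial generator has a variable in the prime `P i`. Hence `varIdeal K A` lies between
    -- `I` and `P i`; being prime it contains some `P j`, and irredundancy gives `j = i`.
    have hIA : ⨅ j, P j ≤ varIdeal K A := by
      rw [← hP.eq_iInf, Ideal.span_le]
      rintro _ ⟨a, ha, rfl⟩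
      have haP : monomial a (1 : K) ∈ P i :=
        iInf_le P i (hP.eq_iInf.le (Ideal.subset_span ⟨a, ha, rfl⟩))
      rw [monomial_eq, map_one, one_mul, Finsupp.prod, (hP.isPrime i).prod_mem_iff] at haP
      obtain ⟨v, hv, hvP⟩ := haP
      refine mem_varIdeal.2 fun m hm => ⟨v, ?_, ?_⟩
      · exact Finset.mem_filter.2 ⟨Finset.mem_univ _, (hP.isPrime i).mem_of_pow_mem _ hvP⟩
      · obtain rfl := Finset.mem_singleton.1 (support_monomial_subset hm)
        exact Finsupp.mem_support_iff.1 hv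
    rw [← Finset.inf_univ_eq_iInf, (varIdeal_isPrime A).inf_le'] at hIA
    obtain ⟨j, -, hj⟩ := hIA
    obtain rfl := hanti j i (hj.trans hA)
    exact ⟨A, le_antisymm hj hA⟩
  choose A hA using hvar
  have hsub : ∀ i j, A i ⊆ A j → i = j := fun i j h =>
    hanti i j (by rw [hA i, hA j]; exact varIdeal_le_varIdeal.2 h)
  refine ⟨Finset.univ.image A, ?_, ?_, ?_⟩
  · rw [hP.eq_iInf, coverIdeal, Finset.inf_image, ← Finset.inf_univ_eq_iInf]
    exact Finset.inf_congr rfl fun i _ => hA i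
  · rw [Finset.card_image_of_injective _ fun i j h => hsub i j h.le, Finset.card_univ,
      Fintype.card_fin]
  · simp only [Finset.coe_image, Finset.coe_univ, Set.image_univ]
    rintro _ ⟨i, rfl⟩ _ ⟨j, rfl⟩ hne h
    exact hne (congrArg A (hsub i j h))

end Ideals

/-! ### Combinatorics of minimal generators -/

section Covers

variable {n : ℕ}

theorem IsCover.mono {F G : Finset (Finset (Fin n))} {m : Fin n →₀ ℕ} (h : G ⊆ F)
    (hm : IsCover F m) : IsCover G m :=
  fun A hA => hm A (h hA)

theorem exists_isCover_degree_le {F : Finset (Finset (Fin n))} {m : Fin n →₀ ℕ}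
    (hm : IsCover F m) : ∃ w ≤ m, IsCover F w ∧ w.degree ≤ F.card := by
  classical
  -- `choose!` needs a default index, so `n = 0` is treated apart.
  rcases isEmpty_or_nonempty (Fin n) with _ | _
  · exact ⟨m, le_rfl, hm, by simp [Subsingleton.elim m 0]⟩
  choose! g hg hmg using hm
  -- One chosen index per member suffices; repeated choices only lower the degree.
  refine ⟨∑ u ∈ F.image g, Finsupp.single u 1, ?_, ?_, ?_⟩
  · intro u
    simp only [Finsupp.coe_finsetSum, Finset.sum_apply, Finsupp.single_apply, Finset.sum_ite_eq']
    split_ifs with h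
    · obtain ⟨A, hA, rfl⟩ := Finset.mem_image.1 h
      exact Nat.one_le_iff_ne_zero.2 (hmg A hA)
    · exact Nat.zero_le _
  · intro A hA
    refine ⟨g A, hg A hA, ?_⟩
    simp only [Finsupp.coe_finsetSum, Finset.sum_apply, Finsupp.single_apply, Finset.sum_ite_eq']
    rw [if_pos (Finset.mem_image_of_mem g hA)]
    exact one_ne_zero
  · rw [map_sum]
    simpa using Finset.card_image_le

/-- A minimal generator of an intersection of `r` monomial primes has degree at most `r`. -/
theorem degree_le_card_of_minimal {F : Finset (Finset (Fin n))} {u : Fin n →₀ ℕ}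
    (hu : Minimal (IsCover F) u) : u.degree ≤ F.card := by
  obtain ⟨w, hw, hcw, hd⟩ := exists_isCover_degree_le hu.prop
  rwa [← hu.eq_of_le hcw hw]

/-- The factor `x_v` serves all members containing `v` at once, and each remaining member costs at
most one more variable. -/
theorem degree_le_of_minimal_of_ne_zero {F : Finset (Finset (Fin n))} {u : Fin n →₀ ℕ}
    (hu : Minimal (IsCover F) u) {v : Fin n} (hv : u v ≠ 0) :
    u.degree ≤ (F.filter (v ∉ ·)).card + 1 := by
  have hle : Finsupp.single v 1 ≤ u := Finsupp.single_le_iff.2 (Nat.one_le_iff_ne_zero.2 hv)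
  have h1 : IsCover (F.filter (v ∉ ·)) (u - Finsupp.single v 1) := by
    rw [isCover_filter_notMem one_ne_zero, tsub_add_cancel_of_le hle]
    exact hu.prop
  obtain ⟨w, hw, hcw, hd⟩ := exists_isCover_degree_le h1
  rw [isCover_filter_notMem one_ne_zero] at hcw
  have h2 : w + Finsupp.single v 1 ≤ u := by
    calc w + Finsupp.single v 1 ≤ u - Finsupp.single v 1 + Finsupp.single v 1 := by gcongr
      _ = u := tsub_add_cancel_of_le hle
  rw [← hu.eq_of_le hcw h2]
  simpa using hd

theorem minimal_isCover_single {A : Finset (Fin n)} {z : Fin n} (hz : z ∈ A) :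
    Minimal (IsCover {A}) (Finsupp.single z 1) := by
  refine ⟨fun B hB => ?_, fun w hw hle => ?_⟩
  · rw [Finset.mem_singleton.1 hB]
    exact ⟨z, hz, by simp⟩
  · obtain ⟨y, -, hy⟩ := hw A (Finset.mem_singleton_self A)
    have h1 := hle y
    by_cases hzy : z = y
    · subst hzy
      exact Finsupp.single_le_iff.2 (Nat.one_le_iff_ne_zero.2 hy)
    · rw [Finsupp.single_apply, if_neg hzy] at h1
      omega

variable {F : Finset (Finset (Fin n))} {v : Fin n}

theorem filter_card_add_filter_notMem_card :
    (F.filter (v ∈ ·)).card + (F.filter (v ∉ ·)).card = F.card :=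
  Finset.card_filter_add_card_filter_not _

/-- If `(I, x_v)` is the intersection of the components of `I` containing `x_v` and `I` has a minimal
generator of degree `r`, then exactly one component contains `x_v`. -/
theorem card_filter_mem_le_one
    (hF : ∀ m, IsCover (F.image (insert v)) m ↔ IsCover (F.filter (v ∈ ·)) m)
    (hne : (F.filter (v ∉ ·)).Nonempty) {u : Fin n →₀ ℕ} (hu : Minimal (IsCover F) u)
    (hd : u.degree = F.card) : (F.filter (v ∈ ·)).card ≤ 1 := by
  have hcard := filter_card_add_filter_notMem_card (F := F) (v := v)
  -- If `v` is not used, `u` is also a minimal cover of the members containing `v`, of which there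
  -- are fewer than `r`. Otherwise its degree is at most one more than the number of members missing
  -- `v`.
  by_cases hv : u v = 0
  · have : Minimal (IsCover (F.filter (v ∈ ·))) u := by
      refine ⟨hu.prop.mono (Finset.filter_subset _ _), fun w hw hle => ?_⟩
      have hwv : w v = 0 := by have := hle v; omega
      exact hu.le_of_le ((isCover_image_insert hwv).1 ((hF w).2 hw)) hle
    have := degree_le_card_of_minimal this
    have := hne.card_pos
    omega
  · have := degree_le_of_minimal_of_ne_zero hu hv
    omega

/-- If no component contained `x_v`, the intersection over them would be the unit ideal, whereas
`(I, x_v)` is proper. -/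
theorem filter_mem_nonempty
    (hF : ∀ m, IsCover (F.image (insert v)) m ↔ IsCover (F.filter (v ∈ ·)) m)
    (hne : F.Nonempty) : (F.filter (v ∈ ·)).Nonempty := by
  by_contra h
  rw [Finset.not_nonempty_iff_eq_empty] at h
  obtain ⟨A, hA⟩ := hne
  have h0 : IsCover (F.image (insert v)) 0 := by
    rw [hF, h]
    intro A hA
    simp at hA
  obtain ⟨u, -, hu⟩ := h0 _ (Finset.mem_image_of_mem _ hA)
  exact hu rfl

/-- A minimal generator of degree `r - 1` of `I : x_v` yields one of degree `r` of `I` when only one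
component contains `x_v`. -/
theorem exists_minimal_degree_eq_card (hanti : IsAntichain (· ⊆ ·) (F : Set (Finset (Fin n))))
    (hF : ∀ m, IsCover (F.image (insert v)) m ↔ IsCover (F.filter (v ∈ ·)) m)
    (hB : (F.filter (v ∈ ·)).card = 1) {u : Fin n →₀ ℕ}
    (hu : Minimal (IsCover (F.filter (v ∉ ·))) u)
    (hd : u.degree = (F.filter (v ∉ ·)).card) :
    ∃ w, Minimal (IsCover F) w ∧ w.degree = F.card := by
  have hcard := filter_card_add_filter_notMem_card (F := F) (v := v)
  obtain ⟨B, hFB⟩ := Finset.card_eq_one.1 hB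
  obtain ⟨hBF, hvB⟩ := Finset.mem_filter.1 (hFB ▸ Finset.mem_singleton_self B :
    B ∈ F.filter (v ∈ ·))
  -- Here `(I, x_v)` is the prime of `B`, so its variables other than `x_v` already lie in `I`.
  have hmem : ∀ y ∈ B, y ≠ v → ∀ A ∈ F, y ∈ A := by
    intro y hy hyv A hA
    have h1 : IsCover F (Finsupp.single y 1) := by
      refine (isCover_image_insert (v := v) (by simp [hyv])).1 ((hF _).2 ?_)
      rw [hFB]
      exact (minimal_isCover_single hy).prop
    obtain ⟨z, hz, hyz⟩ := h1 A hA
    have : y = z := by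
      by_contra hne
      simp [hne] at hyz
    rwa [this]
  obtain ⟨u, hu, hd, hdisj⟩ : ∃ u, Minimal (IsCover (F.filter (v ∉ ·))) u ∧
      u.degree = (F.filter (v ∉ ·)).card ∧ ∀ y ∈ B, y ≠ v → u y = 0 := by
    -- The generator must avoid `B ∖ {v}`. With a single remaining component it may have to be
    -- replaced, using the antichain condition; otherwise a variable of `B ∖ {v}` dividing it would
    -- be all of it, forcing degree 1.
    by_cases hb : (F.filter (v ∉ ·)).card = 1
    · obtain ⟨A, hFA⟩ := Finset.card_eq_one.1 hb
      obtain ⟨hAF, hvA⟩ := Finset.mem_filter.1 (hFA ▸ Finset.mem_singleton_self A :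
        A ∈ F.filter (v ∉ ·))
      have hAB : ¬ A ⊆ B := hanti hAF hBF fun h => hvA (h ▸ hvB)
      obtain ⟨z, hzA, hzB⟩ := Finset.not_subset.1 hAB
      refine ⟨Finsupp.single z 1, hFA ▸ minimal_isCover_single hzA, by simp [hFA], ?_⟩
      intro y hy _
      have : z ≠ y := fun h => hzB (h ▸ hy)
      simp [this]
    · refine ⟨u, hu, hd, fun y hy hyv => ?_⟩
      by_contra huy
      have h1 : IsCover (F.filter (v ∉ ·)) (Finsupp.single y 1) := fun A hA =>
        ⟨y, hmem y hy hyv A (Finset.mem_filter.1 hA).1, by simp⟩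
      have h2 := hu.eq_of_le h1 (Finsupp.single_le_iff.2 (Nat.one_le_iff_ne_zero.2 huy))
      rw [← h2] at hd
      exact hb (by simpa using hd.symm)
  refine ⟨u + Finsupp.single v 1, ⟨(isCover_filter_notMem one_ne_zero).1 hu.prop, ?_⟩, ?_⟩
  · intro w hw hle
    obtain ⟨y, hy, hwy⟩ := hw B hBF
    -- As `u` vanishes on `B ∖ {v}`, a cover below `u + δ_v` can meet `B` only at `v`.
    have hwv : w v ≠ 0 := by
      by_cases hyv : y = v
      · rwa [← hyv]
      · have h1 := hle y
        have h2 := hdisj y hy hyv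
        have h3 : v ≠ y := Ne.symm hyv
        simp [h2, h3] at h1
        exact absurd h1 hwy
    have hle' : Finsupp.single v 1 ≤ w := Finsupp.single_le_iff.2 (Nat.one_le_iff_ne_zero.2 hwv)
    have h1 : IsCover (F.filter (v ∉ ·)) (w - Finsupp.single v 1) := by
      rwa [isCover_filter_notMem one_ne_zero, tsub_add_cancel_of_le hle']
    have h2 := hu.le_of_le h1 (tsub_le_iff_right.2 hle)
    calc u + Finsupp.single v 1 ≤ w - Finsupp.single v 1 + Finsupp.single v 1 := by gcongr
      _ = w := tsub_add_cancel_of_le hle'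
  · simp only [map_add, Finsupp.degree_single, hd]
    omega

end Covers

/-! ### Koszul chains with polynomial coefficients -/

section Koszul

variable {K : Type*} [Field K] {n : ℕ}

/-- Every cycle of `R/I ⊗ ⋀ⁱ Rⁿ` of degree `j` is a boundary. -/
def TorVanishes (I : Ideal (MvPolynomial (Fin n) K)) (i j : ℕ) : Prop :=
  koszulCycles n (quotientGrading I) i j ≤ koszulBoundaries n (quotientGrading I) i j

/-- `Tor_i(R/I, K)_j = 0` whenever `j - i > m`. -/
def RegLE (I : Ideal (MvPolynomial (Fin n) K)) (m : ℕ) : Prop :=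
  ∀ i j, i + m < j → TorVanishes I i j

theorem RegLE.mono {I : Ideal (MvPolynomial (Fin n) K)} {m m' : ℕ} (h : RegLE I m) (hm : m ≤ m') :
    RegLE I m' :=
  fun i j hij => h i j (by omega)

theorem nontrivial_gradedTor_iff (I : Ideal (MvPolynomial (Fin n) K)) (i j : ℕ) :
    Nontrivial (GradedTor n (quotientGrading I) i j) ↔ ¬ TorVanishes I i j := by
  rw [GradedTor, Submodule.Quotient.nontrivial_iff, ne_eq, Submodule.submoduleOf_eq_top,
    TorVanishes]

theorem koszulD_map {M N : Type*} [AddCommGroup M] [Module (MvPolynomial (Fin n) K) M]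
    [AddCommGroup N] [Module (MvPolynomial (Fin n) K) N]
    (φ : M →ₗ[MvPolynomial (Fin n) K] N) (c : Finset (Fin n) → M) (T : Finset (Fin n)) :
    koszulD K N (fun S => φ (c S)) T = φ (koszulD K M c T) := by
  simp only [koszulD_apply, map_sum, map_zsmul, map_smul]

/-- The polynomial chains of homological degree `i` and internal degree `j`. -/
noncomputable abbrev polyPiece (K : Type*) [Field K] (n : ℕ) (i j : ℕ) :
    Submodule K (Finset (Fin n) → MvPolynomial (Fin n) K) :=
  koszulPiece n (homogeneousSubmodule (Fin n) K) i j

theorem mem_koszulPiece {M : Type*} [AddCommGroup M] [Module K M] {ℳ : ℕ → Submodule K M}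
    {i j : ℕ} {c : Finset (Fin n) → M} :
    c ∈ koszulPiece n ℳ i j ↔
      ∀ S, (S.card = i ∧ i ≤ j → c S ∈ ℳ (j - i)) ∧ (¬ (S.card = i ∧ i ≤ j) → c S = 0) := by
  simp only [koszulPiece, Submodule.mem_pi, Set.mem_univ, true_implies]
  refine forall_congr' fun S => ?_
  split_ifs with h <;> simp [h]

theorem mk_mem_koszulPiece {I : Ideal (MvPolynomial (Fin n) K)} {i j : ℕ}
    {c : Finset (Fin n) → MvPolynomial (Fin n) K} (hc : c ∈ polyPiece K n i j) :
    (fun S => Ideal.Quotient.mk I (c S)) ∈ koszulPiece n (quotientGrading I) i j := by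
  rw [mem_koszulPiece] at hc ⊢
  exact fun S => ⟨fun h => ⟨c S, (hc S).1 h, rfl⟩, fun h => by rw [(hc S).2 h, map_zero]⟩

theorem exists_lift_koszulPiece {I : Ideal (MvPolynomial (Fin n) K)} {i j : ℕ}
    {c : Finset (Fin n) → MvPolynomial (Fin n) K ⧸ I}
    (hc : c ∈ koszulPiece n (quotientGrading I) i j) :
    ∃ c' ∈ polyPiece K n i j, (fun S => Ideal.Quotient.mk I (c' S)) = c := by
  rw [mem_koszulPiece] at hc
  have : ∀ S, ∃ f : MvPolynomial (Fin n) K, Ideal.Quotient.mk I f = c S ∧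
      (S.card = i ∧ i ≤ j → f ∈ homogeneousSubmodule (Fin n) K (j - i)) ∧
      (¬ (S.card = i ∧ i ≤ j) → f = 0) := by
    intro S
    by_cases h : S.card = i ∧ i ≤ j
    · obtain ⟨f, hf, hfc⟩ := (hc S).1 h
      exact ⟨f, hfc, fun _ => hf, fun h' => absurd h h'⟩
    · exact ⟨0, by rw [(hc S).2 h, map_zero], fun h' => absurd h' h, fun _ => rfl⟩
  choose c' h1 h2 using this
  exact ⟨c', mem_koszulPiece.2 h2, funext h1⟩

theorem koszulD_mk (I : Ideal (MvPolynomial (Fin n) K))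
    (c : Finset (Fin n) → MvPolynomial (Fin n) K) (T : Finset (Fin n)) :
    koszulD K (MvPolynomial (Fin n) K ⧸ I) (fun S => Ideal.Quotient.mk I (c S)) T =
      Ideal.Quotient.mk I (koszulD K _ c T) :=
  koszulD_map (Submodule.mkQ I) c T

/-- The vanishing of `Tor_i(R/I, K)_j` in terms of polynomial chains. -/
theorem torVanishes_iff {I : Ideal (MvPolynomial (Fin n) K)} {i j : ℕ} :
    TorVanishes I i j ↔ ∀ c ∈ polyPiece K n i j, (∀ T, koszulD K _ c T ∈ I) →
      ∃ b ∈ polyPiece K n (i + 1) j, ∀ T, c T - koszulD K _ b T ∈ I := by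
  constructor
  · intro h c hc hd
    obtain ⟨b, hb, hbc⟩ := h (show (fun S => Ideal.Quotient.mk I (c S)) ∈ _ from
      ⟨mk_mem_koszulPiece hc, by
        rw [SetLike.mem_coe, LinearMap.mem_ker]
        funext T
        exact (koszulD_mk I c T).trans (Ideal.Quotient.eq_zero_iff_mem.2 (hd T))⟩)
    obtain ⟨b', hb', rfl⟩ := exists_lift_koszulPiece hb
    refine ⟨b', hb', fun T => ?_⟩
    rw [← Ideal.Quotient.mk_eq_mk_iff_sub_mem, ← koszulD_mk]
    exact (congrFun hbc T).symm
  · rintro h c ⟨hc, hd⟩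
    obtain ⟨c', hc', rfl⟩ := exists_lift_koszulPiece hc
    obtain ⟨b, hb, hbc⟩ := h c' hc' fun T => by
      rw [← Ideal.Quotient.eq_zero_iff_mem, ← koszulD_mk]
      exact congrFun (LinearMap.mem_ker.1 hd) T
    refine ⟨_, mk_mem_koszulPiece hb, ?_⟩
    funext T
    refine (koszulD_mk I b T).trans ?_
    exact ((Ideal.Quotient.mk_eq_mk_iff_sub_mem _ _).2 (hbc T)).symm

theorem koszulD_mem_of_forall_mem {I : Ideal (MvPolynomial (Fin n) K)}
    {c : Finset (Fin n) → MvPolynomial (Fin n) K} (hc : ∀ T, c T ∈ I) (T : Finset (Fin n)) :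
    koszulD K _ c T ∈ I := by
  rw [koszulD_apply]
  exact Submodule.sum_mem _ fun v _ => zsmul_mem (Ideal.mul_mem_left _ _ (hc _)) _

theorem koszulD_mem_polyPiece {i j : ℕ} {b : Finset (Fin n) → MvPolynomial (Fin n) K}
    (hb : b ∈ polyPiece K n (i + 1) j) : koszulD K _ b ∈ polyPiece K n i j := by
  refine (koszulBoundaries_le_koszulCycles n (homogeneousSubmodule (Fin n) K) ?_ i j
    ⟨b, hb, rfl⟩).1
  intro d v a ha
  rw [mem_homogeneousSubmodule] at ha ⊢
  rw [add_comm d 1]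
  exact (isHomogeneous_X K v).mul ha

theorem X_smul_mem_polyPiece {i j : ℕ} (v : Fin n) {b : Finset (Fin n) → MvPolynomial (Fin n) K}
    (hb : b ∈ polyPiece K n i j) :
    (X v : MvPolynomial (Fin n) K) • b ∈ polyPiece K n i (j + 1) := by
  rw [mem_koszulPiece] at hb ⊢
  refine fun S => ⟨fun h => ?_, fun h => ?_⟩
  · rw [Pi.smul_apply, smul_eq_mul]
    by_cases hj : i ≤ j
    · have := (hb S).1 ⟨h.1, hj⟩
      rw [mem_homogeneousSubmodule] at this ⊢
      rw [show j + 1 - i = 1 + (j - i) by omega]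
      exact (isHomogeneous_X K v).mul this
    · rw [(hb S).2 fun h' => hj h'.2, mul_zero]
      exact Submodule.zero_mem _
  · rw [Pi.smul_apply, (hb S).2 fun h' => h ⟨h'.1, by omega⟩, smul_zero]

theorem divMonomial_mem_polyPiece {i j : ℕ} (v : Fin n)
    {b : Finset (Fin n) → MvPolynomial (Fin n) K} (hb : b ∈ polyPiece K n i j) :
    (fun S => (b S).divMonomial (Finsupp.single v 1)) ∈ polyPiece K n i (j - 1) := by
  rw [mem_koszulPiece] at hb ⊢
  -- Stated as `m.degree + 1 = j - i` to rule out `j = i`: then the quotient is zero and the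
  -- truncated `j - 1` does no harm.
  have key : ∀ S : Finset (Fin n), S.card = i ∧ i ≤ j →
      ∀ m, coeff m ((b S).divMonomial (Finsupp.single v 1)) ≠ 0 → m.degree + 1 = j - i := by
    intro S h m hm
    rw [coeff_divMonomial] at hm
    have := (mem_homogeneousSubmodule _ _).1 ((hb S).1 h) hm
    rw [map_add, Pi.one_def, ← Finsupp.degree_eq_weight_one] at this
    simp at this
    omega
  refine fun S => ⟨fun h => ?_, fun h => ?_⟩
  · rw [mem_homogeneousSubmodule]
    intro m hm
    have := key S ⟨h.1, by omega⟩ m hm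
    rw [Pi.one_def, ← Finsupp.degree_eq_weight_one]
    omega
  · by_cases h' : S.card = i ∧ i ≤ j
    · ext m
      by_contra hm
      have := key S h' m hm
      exact h ⟨h'.1, by omega⟩
    · simp only [(hb S).2 h']
      exact zero_divMonomial _

theorem koszulSign_mul_self (v : Fin n) (T : Finset (Fin n)) :
    koszulSign v T * koszulSign v T = 1 := by
  rw [koszulSign, ← mul_pow]
  simp

/-- Exterior multiplication by the basis element `e_v`. -/
noncomputable def koszulWedge (v : Fin n) (c : Finset (Fin n) → MvPolynomial (Fin n) K) (S : Finset (Fin n)) :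
    MvPolynomial (Fin n) K :=
  if v ∈ S then koszulSign v S • c (S.erase v) else 0

theorem koszulWedge_mem_polyPiece {i j : ℕ} (v : Fin n)
    {c : Finset (Fin n) → MvPolynomial (Fin n) K} (hc : c ∈ polyPiece K n i j) :
    koszulWedge v c ∈ polyPiece K n (i + 1) (j + 1) := by
  rw [mem_koszulPiece] at hc ⊢
  refine fun S => ⟨fun h => ?_, fun h => ?_⟩
  · unfold koszulWedge
    split_ifs with hv
    · have hcard := Finset.card_erase_of_mem hv
      have := (hc (S.erase v)).1 ⟨by omega, by omega⟩
      rw [show j + 1 - (i + 1) = j - i by omega]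
      exact zsmul_mem this _
    · exact Submodule.zero_mem _
  · unfold koszulWedge
    split_ifs with hv
    · have hcard := Finset.card_erase_of_mem hv
      have hpos : 0 < S.card := Finset.card_pos.2 ⟨v, hv⟩
      rw [(hc (S.erase v)).2 fun h' => h ⟨by omega, by omega⟩, smul_zero]
    · rfl

/-- Multiplication by `x_v` on the Koszul complex is null-homotopic. -/
theorem koszulD_koszulWedge (v : Fin n) (c : Finset (Fin n) → MvPolynomial (Fin n) K)
    (T : Finset (Fin n)) :
    koszulD K _ (koszulWedge v c) T + koszulWedge v (koszulD K _ c) T = X v * c T := by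
  by_cases hv : v ∈ T
  · obtain ⟨S, hS, rfl⟩ : ∃ S, v ∉ S ∧ T = insert v S :=
      ⟨T.erase v, Finset.notMem_erase v T, (Finset.insert_erase hv).symm⟩
    have hC : Sᶜ = insert v (insert v S)ᶜ := by
      ext u; by_cases hu : u = v <;> simp [hu, hS]
    have hsv : koszulSign v (insert v S) = koszulSign v S :=
      koszulSign_insert_of_not_lt (lt_irrefl v)
    rw [koszulWedge, if_pos hv, Finset.erase_insert hS, koszulD_apply, koszulD_apply, hC,
      Finset.sum_insert (by simp), smul_add, smul_smul, hsv, koszulSign_mul_self, one_smul,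
      smul_eq_mul, add_left_comm, Finset.smul_sum, ← Finset.sum_add_distrib,
      Finset.sum_eq_zero, add_zero]
    intro u hu
    simp only [Finset.mem_compl, Finset.mem_insert, not_or] at hu
    obtain ⟨huv, huS⟩ := hu
    have hsw := koszulSign_swap huS hS huv
    have h1 := koszulSign_mul_self u S
    have h2 := koszulSign_mul_self u (insert v S)
    have hvu : koszulSign v (insert u (insert v S)) = koszulSign v (insert u S) := by
      rw [Finset.insert_comm]
      exact koszulSign_insert_of_not_lt (lt_irrefl v)
    have hsign : koszulSign u (insert v S) * koszulSign v (insert u S) =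
        - (koszulSign v S * koszulSign u S) := by
      -- Multiply the swap relation by the two signs of `u` and cancel their squares.
      linear_combination koszulSign u S * koszulSign u (insert v S) * hsw -
        koszulSign u (insert v S) * koszulSign v (insert u S) * h1 -
        koszulSign v S * koszulSign u S * h2
    have herase : (insert u (insert v S)).erase v = insert u S := by
      rw [Finset.insert_comm]
      exact Finset.erase_insert (by simp [Ne.symm huv, hS])
    rw [koszulWedge, if_pos (by simp), hvu, herase,
      smul_comm (X u : MvPolynomial (Fin n) K) (koszulSign _ _), smul_smul, hsign, smul_smul,
      neg_smul, neg_add_cancel]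
  · rw [koszulWedge, if_neg hv, add_zero, koszulD_apply, Finset.sum_eq_single v]
    · rw [koszulWedge, if_pos (Finset.mem_insert_self v T), Finset.erase_insert hv,
        koszulSign_insert_of_not_lt (lt_irrefl v),
        smul_comm (X v : MvPolynomial (Fin n) K) (koszulSign _ _), smul_smul,
        koszulSign_mul_self, one_smul, smul_eq_mul]
    · intro u _ huv
      rw [koszulWedge, if_neg (by simp [Ne.symm huv, hv]), smul_zero, smul_zero]
    · intro h
      simp [hv] at h

end Koszul

/-! ### The regularity bound and when it is attained -/

section Regularity

variable {K : Type*} [Field K] {n : ℕ} {F : Finset (Finset (Fin n))}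

/-- A cycle of `R/I` whose image in `R/(I, x_v)` is a boundary is homologous to `x_v` times a
cycle of `R/(I : x_v)`. -/
theorem exists_cycle_colon (v : Fin n) {i j : ℕ}
    (h : TorVanishes (coverIdeal K (F.image (insert v))) i j)
    {c : Finset (Fin n) → MvPolynomial (Fin n) K} (hc : c ∈ polyPiece K n i j)
    (hd : ∀ T, koszulD K _ c T ∈ coverIdeal K F) :
    ∃ b ∈ polyPiece K n (i + 1) j, ∃ e ∈ polyPiece K n i (j - 1),
      (∀ T, koszulD K _ e T ∈ coverIdeal K (F.filter (v ∉ ·))) ∧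
      ∀ T, c T - koszulD K _ b T - X v * e T ∈ coverIdeal K F := by
  obtain ⟨b, hb, hcb⟩ := torVanishes_iff.1 h c hc fun T => coverIdeal_le_image_insert F v (hd T)
  have hpiece : c - koszulD K _ b ∈ polyPiece K n i j :=
    Submodule.sub_mem _ hc (koszulD_mem_polyPiece hb)
  have hmem := fun T => sub_X_mul_divMonomial_mem (hcb T)
  refine ⟨b, hb, _, divMonomial_mem_polyPiece v hpiece, fun T => ?_, hmem⟩
  rw [mem_coverIdeal_filter_notMem one_ne_zero, pow_one]
  set e : Finset (Fin n) → MvPolynomial (Fin n) K :=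
    fun S => ((c - koszulD K _ b) S).divMonomial (Finsupp.single v 1)
  -- Applying the differential to a chain with entries in `I` gives `d c - x_v d e ∈ I`; since `d c
  -- ∈ I`, the entries of `d e` lie in `I : x_v`.
  have h1 := koszulD_mem_of_forall_mem (c := c - koszulD K _ b - (X v : MvPolynomial (Fin n) K) • e)
    hmem T
  rw [map_sub, map_sub, koszulD_koszulD, sub_zero, map_smul, Pi.sub_apply, Pi.smul_apply,
    smul_eq_mul] at h1
  rw [mul_comm]
  exact (Submodule.sub_mem_iff_right _ (hd T)).1 h1

/-- Exactness of `Tor_i(R/(I : x_v))_(j-1) → Tor_i(R/I)_j → Tor_i(R/(I, x_v))_j`. -/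
theorem torVanishes_of_colon (v : Fin n) {i j : ℕ} (hij : i < j)
    (hadd : TorVanishes (coverIdeal K (F.image (insert v))) i j)
    (hcolon : TorVanishes (coverIdeal K (F.filter (v ∉ ·))) i (j - 1)) :
    TorVanishes (coverIdeal K F) i j := by
  refine torVanishes_iff.2 fun c hc hd => ?_
  obtain ⟨b, hb, e, he, hde, hbe⟩ := exists_cycle_colon v hadd hc hd
  obtain ⟨f, hf, hef⟩ := torVanishes_iff.1 hcolon e he hde
  refine ⟨b + (X v : MvPolynomial (Fin n) K) • f, Submodule.add_mem _ hb ?_, fun T => ?_⟩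
  · have := X_smul_mem_polyPiece v hf
    rwa [Nat.sub_add_cancel (by omega)] at this
  · have h1 := (mem_coverIdeal_filter_notMem one_ne_zero).1 (hef T)
    rw [map_add, map_smul, Pi.add_apply, Pi.smul_apply, smul_eq_mul]
    convert Submodule.add_mem _ (hbe T) h1 using 1
    ring

/-- If `x_v` is a nonzerodivisor on `R/I`, then `Tor_i(R/I)_j → Tor_i(R/(I, x_v))_j` is injective. -/
theorem torVanishes_of_forall_notMem (v : Fin n) {i j : ℕ} (hij : i < j)
    (hadd : TorVanishes (coverIdeal K (F.image (insert v))) i j) (hv : ∀ A ∈ F, v ∉ A) :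
    TorVanishes (coverIdeal K F) i j := by
  refine torVanishes_iff.2 fun c hc hd => ?_
  obtain ⟨b, hb, e, he, hde, hbe⟩ := exists_cycle_colon v hadd hc hd
  rw [Finset.filter_true_of_mem hv] at hde
  -- Now `I : x_v = I`, so `e` is a cycle modulo `I`, and the homotopy makes `x_v e` a boundary
  -- modulo `I`.
  refine ⟨b + koszulWedge v e, Submodule.add_mem _ hb ?_, fun T => ?_⟩
  · have := koszulWedge_mem_polyPiece v he
    rwa [Nat.sub_add_cancel (by omega)] at this
  · have h1 : koszulWedge v (koszulD K _ e) T ∈ coverIdeal K F := by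
      unfold koszulWedge
      split_ifs
      · exact zsmul_mem (hde _) _
      · exact Submodule.zero_mem _
    rw [map_add, Pi.add_apply]
    convert Submodule.add_mem _ (hbe T) h1 using 1
    linear_combination -koszulD_koszulWedge v e T

/-- `reg(R/I) ≤ r - 1` for an intersection `I` of `r ≥ 1` monomial primes. -/
theorem regLE_coverIdeal (F : Finset (Finset (Fin n))) (hF : F.Nonempty) :
    RegLE (coverIdeal K F) (F.card - 1) := by
  -- Inserting `v` where it is missing shrinks a complement; the summand `+ 1` makes the measure
  -- also drop when a full member is discarded.
  induction hN : ∑ A ∈ F, (Aᶜ.card + 1) using Nat.strong_induction_on generalizing F with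
  | _ N ih =>
  subst hN
  by_cases hv : ∃ v, ∃ A ∈ F, v ∉ A
  · obtain ⟨v, A, hA, hvA⟩ := hv
    have hcard : (F.image (insert v)).card ≤ F.card := Finset.card_image_le
    have hadd : RegLE (coverIdeal K (F.image (insert v))) (F.card - 1) := by
      refine (ih _ ?_ _ (hF.image _) rfl).mono (by omega)
      calc ∑ B ∈ F.image (insert v), (Bᶜ.card + 1) ≤ ∑ B ∈ F, ((insert v B)ᶜ.card + 1) :=
            Finset.sum_image_le_of_nonneg (fun _ _ => Nat.zero_le _)
        _ < ∑ B ∈ F, (Bᶜ.card + 1) := by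
            refine Finset.sum_lt_sum (fun B _ => ?_) ⟨A, hA, ?_⟩
            · have : (insert v B)ᶜ.card ≤ Bᶜ.card :=
                Finset.card_le_card (Finset.compl_subset_compl.2 (Finset.subset_insert v B))
              omega
            · have : (insert v A)ᶜ.card < Aᶜ.card :=
                Finset.card_lt_card (Finset.compl_ssubset_compl.2 (Finset.ssubset_insert hvA))
              omega
    -- If no member contains `v`, passing to `I : x_v` changes nothing and the induction would
    -- stall, so the nonzerodivisor argument replaces it.
    by_cases hall : ∀ B ∈ F, v ∉ B
    · exact fun i j hij => torVanishes_of_forall_notMem v (by omega) (hadd i j hij) hall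
    · push Not at hall
      obtain ⟨B, hB, hvB⟩ := hall
      have hss : F.filter (v ∉ ·) ⊂ F :=
        Finset.filter_ssubset.2 ⟨B, hB, by simpa using hvB⟩
      have hne : (F.filter (v ∉ ·)).Nonempty := ⟨A, Finset.mem_filter.2 ⟨hA, hvA⟩⟩
      have hlt := Finset.card_lt_card hss
      have hpos := hne.card_pos
      have hcolon : RegLE (coverIdeal K (F.filter (v ∉ ·))) ((F.filter (v ∉ ·)).card - 1) := by
        refine ih _ ?_ _ hne rfl
        exact Finset.sum_lt_sum_of_subset hss.1 hB (by simp [hvB]) (Nat.succ_pos _)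
          fun _ _ _ => Nat.zero_le _
      exact fun i j hij => torVanishes_of_colon v (by omega) (hadd i j hij)
        (hcolon i (j - 1) (by omega))
  -- Every member is now the set of all indices, and chains with `j > i` have coefficients of
  -- positive degree, which lie in `I`.
  · push Not at hv
    intro i j hij
    refine torVanishes_iff.2 fun c hc _ => ⟨0, Submodule.zero_mem _, fun T => ?_⟩
    rw [map_zero, Pi.zero_apply, sub_zero, mem_coverIdeal]
    intro m hm A hA
    rw [mem_support_iff] at hm
    by_cases hT : T.card = i ∧ i ≤ j
    · have h1 := (mem_homogeneousSubmodule _ _).1 (((mem_koszulPiece.1 hc) T).1 hT) hm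
      rw [Pi.one_def, ← Finsupp.degree_eq_weight_one] at h1
      have h2 : m ≠ 0 := by
        rintro rfl
        simp at h1
        omega
      obtain ⟨u, hu⟩ := Finsupp.ne_iff.1 h2
      exact ⟨u, hv u A hA, hu⟩
    · rw [((mem_koszulPiece.1 hc) T).2 hT] at hm
      exact absurd (coeff_zero m) hm

/-- A minimal generator of degree `d` contributes to `Tor_1(R/I, K)_d`. -/
theorem not_torVanishes_of_minimal {u : Fin n →₀ ℕ} (hu : Minimal (IsCover F) u) (h0 : u ≠ 0) :
    ¬ TorVanishes (coverIdeal K F) 1 u.degree := by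
  intro h
  obtain ⟨v, hv⟩ := Finsupp.ne_iff.1 h0
  have hle : Finsupp.single v 1 ≤ u := Finsupp.single_le_iff.2 (Nat.one_le_iff_ne_zero.2 hv)
  set w := u - Finsupp.single v 1 with hw
  have hwu : Finsupp.single v 1 + w = u := add_tsub_cancel_of_le hle
  have hdeg : u.degree = 1 + w.degree := by rw [← hwu, map_add, Finsupp.degree_single]
  -- The cycle is `x^(u - δ_v) e_v`, with differential `x^u`.
  set c : Finset (Fin n) → MvPolynomial (Fin n) K := Pi.single {v} (monomial w 1) with hcdef
  have hc : c ∈ polyPiece K n 1 u.degree := by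
    rw [mem_koszulPiece]
    refine fun S => ⟨fun hS => ?_, fun hS => ?_⟩
    · by_cases hSv : S = {v}
      · rw [hcdef, hSv, Pi.single_eq_same, mem_homogeneousSubmodule]
        exact isHomogeneous_monomial _ (by omega)
      · rw [hcdef, Pi.single_eq_of_ne hSv]
        exact Submodule.zero_mem _
    · rw [hcdef, Pi.single_eq_of_ne]
      rintro rfl
      exact hS ⟨Finset.card_singleton v, by omega⟩
  have hempty : koszulD K _ c ∅ = monomial u 1 := by
    rw [koszulD_apply, Finset.sum_eq_single v]
    · rw [insert_empty_eq, hcdef, Pi.single_eq_same, smul_eq_mul, X, monomial_mul, hwu, one_mul]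
      simp [koszulSign]
    · intro y _ hyv
      rw [insert_empty_eq, hcdef, Pi.single_eq_of_ne (by simpa using hyv), smul_zero, smul_zero]
    · simp
  have hd : ∀ T, koszulD K _ c T ∈ coverIdeal K F := by
    intro T
    by_cases hT : T = ∅
    · rw [hT, hempty]
      exact monomial_mem_coverIdeal.2 hu.prop
    · rw [koszulD_apply, Finset.sum_eq_zero]
      · exact Submodule.zero_mem _
      · intro y hy
        have : insert y T ≠ {v} := by
          intro hyT
          have h1 := congrArg Finset.card hyT
          rw [Finset.card_insert_of_notMem (Finset.mem_compl.1 hy), Finset.card_singleton] at h1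
          exact hT (Finset.card_eq_zero.1 (by omega))
        rw [hcdef, Pi.single_eq_of_ne this, smul_zero, smul_zero]
  obtain ⟨b, -, hb⟩ := torVanishes_iff.1 h c hc hd
  -- If `c` were a boundary modulo `I`, then `x^u` would be a combination of the variables with
  -- coefficients in `I`; but by minimality no `x^(u - δ_y)` lies in `I`.
  have h1 : koszulD K _ (c - koszulD K _ b) ∅ = monomial u 1 := by
    rw [map_sub, koszulD_koszulD, sub_zero, hempty]
  have h2 := congrArg (coeff u) h1
  rw [coeff_koszulD, coeff_monomial, if_pos rfl, Finset.sum_eq_zero] at h2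
  · exact zero_ne_one h2
  · intro y _
    split_ifs with hy
    · have h3 : ¬ IsCover F (u - Finsupp.single y 1) := fun h3 => by
        have h4 := DFunLike.congr_fun (hu.eq_of_le h3 tsub_le_self) y
        simp at h4
        omega
      rw [Pi.sub_apply, notMem_support_iff.1 fun h4 => h3 (mem_coverIdeal.1 (hb _) _ h4), smul_zero]
    · exact smul_zero _

/-- The number `r - 1` is always an upper bound; over the integers it is the least one exactly when
attained, since otherwise `r - 2` would bound as well. -/
theorem hasRegularity_coverIdeal_iff (hF : F.Nonempty) :
    HasRegularity n (quotientGrading (coverIdeal K F)) ((F.card : ℤ) - 1) ↔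
      ∃ i j, ¬ TorVanishes (coverIdeal K F) i j ∧ j + 1 = i + F.card := by
  have hpos := hF.card_pos
  have hub : ((F.card : ℤ) - 1) ∈ upperBounds {s : ℤ | ∃ i j : ℕ,
      Nontrivial (GradedTor n (quotientGrading (coverIdeal K F)) i j) ∧ s = (j : ℤ) - i} := by
    rintro s ⟨i, j, hij, rfl⟩
    rw [nontrivial_gradedTor_iff] at hij
    by_contra hlt
    exact hij (regLE_coverIdeal F hF i j (by omega))
  constructor
  · intro h
    by_contra hno
    push Not at hno
    have h2 : ((F.card : ℤ) - 2) ∈ upperBounds {s : ℤ | ∃ i j : ℕ,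
        Nontrivial (GradedTor n (quotientGrading (coverIdeal K F)) i j) ∧ s = (j : ℤ) - i} := by
      rintro s ⟨i, j, hij, rfl⟩
      have h3 := hub ⟨i, j, hij, rfl⟩
      have h4 := hno i j ((nontrivial_gradedTor_iff _ _ _).1 hij)
      omega
    have := h.2 h2
    omega
  · rintro ⟨i, j, hij, hj⟩
    refine ⟨hub, fun s hs => hs ⟨i, j, (nontrivial_gradedTor_iff _ _ _).2 hij, ?_⟩⟩
    omega

theorem coverIdeal_eq_bot_of_empty_mem (h : ∅ ∈ F) : coverIdeal K F = ⊥ := by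
  refine eq_bot_iff.2 fun f hf => ?_
  rw [mem_coverIdeal] at hf
  rw [Submodule.mem_bot, ← support_eq_empty, Finset.eq_empty_iff_forall_notMem]
  intro m hm
  obtain ⟨u, hu, -⟩ := hf m hm ∅ h
  simp at hu

theorem filter_notMem_nonempty {v : Fin n}
    (hv : (X v : MvPolynomial (Fin n) K) ∉ (coverIdeal K F).radical) :
    (F.filter (v ∉ ·)).Nonempty := by
  by_contra h
  rw [Finset.not_nonempty_iff_eq_empty, Finset.filter_eq_empty_iff] at h
  refine hv (Ideal.le_radical (monomial_mem_coverIdeal.2 fun A hA => ⟨v, ?_, by simp⟩))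
  exact not_not.1 (h hA)

theorem exists_minimal_of_not_torVanishes {I : Ideal (MvPolynomial (Fin n) K)}
    (hI : AssDecomposable I) (hIF : I = coverIdeal K F)
    (hanti : IsAntichain (· ⊆ ·) (F : Set (Finset (Fin n)))) (h0 : ∅ ∉ F) {i j : ℕ}
    (hij : ¬ TorVanishes I i j) (hj : j + 1 = i + F.card) :
    ∃ u, Minimal (IsCover F) u ∧ u.degree = F.card := by
  induction hI generalizing F i j with
  | primary I _ hprim =>
    -- A radical primary ideal is prime, so there is one component, and any of its variables is a
    -- generator of degree `1 = r`.
    have hpr : (coverIdeal K F).IsPrime := by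
      rw [← coverIdeal_radical, ← hIF]
      exact Ideal.isPrime_radical hprim
    obtain ⟨A, hA, hle⟩ := hpr.inf_le'.1 (le_refl (F.inf (varIdeal K)))
    have hFA : F = {A} := by
      refine Finset.eq_singleton_iff_unique_mem.2 ⟨hA, fun B hB => ?_⟩
      refine (hanti.eq hA hB ?_).symm
      exact varIdeal_le_varIdeal.1 (hle.trans (Finset.inf_le (f := varIdeal K) hB))
    obtain ⟨z, hz⟩ : A.Nonempty := Finset.nonempty_iff_ne_empty.2 fun h => h0 (h ▸ hA)
    exact ⟨Finsupp.single z 1, hFA ▸ minimal_isCover_single hz, by simp [hFA]⟩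
  | step I _ v k hk hv hass _ _ _ ih =>
    subst hIF
    have hk' : k ≠ 0 := hk.ne'
    rw [colonPow_coverIdeal F v hk'] at ih
    have hcov := isCover_image_insert_iff hk' hass
    have hne := filter_notMem_nonempty hv
    have hne' := filter_mem_nonempty hcov (hne.mono (Finset.filter_subset _ _))
    have hcard := filter_card_add_filter_notMem_card (F := F) (v := v)
    have hpos := hne.card_pos
    have hpos' := hne'.card_pos
    have hadd : TorVanishes (coverIdeal K (F.image (insert v))) i j := by
      rw [coverIdeal_image_insert_eq hk' hass]
      exact regLE_coverIdeal _ hne' i j (by omega)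
    have hcolon : ¬ TorVanishes (coverIdeal K (F.filter (v ∉ ·))) i (j - 1) := fun h =>
      hij (torVanishes_of_colon v (by omega) hadd h)
    -- With `j - i = r - 1` this reads `r - 2 ≤ r - s - 1`, hence `s = 1`, and `I : x_v` attains its
    -- own bound.
    have hle : j - 1 ≤ i + ((F.filter (v ∉ ·)).card - 1) := by
      by_contra hlt
      exact hcolon (regLE_coverIdeal _ hne i (j - 1) (by omega))
    obtain ⟨u, hu, hd⟩ := ih rfl
      (hanti.subset (by exact_mod_cast Finset.filter_subset _ _))
      (fun h => h0 (Finset.mem_filter.1 h).1) hcolon (by omega)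
    exact exists_minimal_degree_eq_card hanti hcov (by omega) hu hd

theorem isMaxGeneratorDegree_iff :
    IsMaxGeneratorDegree (coverIdeal K F) F.card ↔
      ∃ u, Minimal (IsCover F) u ∧ u.degree = F.card := by
  rw [IsMaxGeneratorDegree, minimalGenerators_coverIdeal]
  refine ⟨fun h => h.1, fun h => ⟨h, ?_⟩⟩
  rintro _ ⟨w, hw, rfl⟩
  exact degree_le_card_of_minimal hw

/-- If `(I, x_v)` is generated by variables, then `I = 𝔭 + x_v (I : x_v ^ k)` with `𝔭` generated by
variables. -/
theorem coverIdeal_eq_sup {v : Fin n} {k : ℕ} (hk : k ≠ 0) {B : Finset (Fin n)}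
    (hB : coverIdeal K (F.image (insert v)) = varIdeal K B) :
    coverIdeal K F = varIdeal K (B.erase v) ⊔
      Ideal.span {X v} * colonPow (coverIdeal K F) v k := by
  rw [colonPow_coverIdeal F v hk]
  apply le_antisymm
  · intro f hf
    rw [← f.support_sum_monomial_coeff]
    refine Submodule.sum_mem _ fun m hm => ?_
    have hmF := mem_coverIdeal.1 hf m hm
    have hmono : monomial m (coeff m f) = C (coeff m f) * monomial m 1 := by
      rw [C_mul_monomial, mul_one]
    rw [hmono]
    refine Ideal.mul_mem_left _ _ ?_
    -- A monomial of `I` free of `x_v` is divisible by a variable of `B` other than `x_v`; any other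
    -- can be divided by `x_v`.
    by_cases hmv : m v = 0
    · refine Ideal.mem_sup_left (mem_varIdeal.2 fun m' hm' => ?_)
      obtain rfl := Finset.mem_singleton.1 (support_monomial_subset hm')
      have h1 : monomial m' (1 : K) ∈ varIdeal K B := by
        rw [← hB]
        exact monomial_mem_coverIdeal.2 ((isCover_image_insert hmv).2 hmF)
      obtain ⟨y, hy, hmy⟩ := mem_varIdeal.1 h1 m' hm'
      exact ⟨y, Finset.mem_erase.2 ⟨fun h => hmy (h ▸ hmv), hy⟩, hmy⟩
    · have hle : Finsupp.single v 1 ≤ m :=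
        Finsupp.single_le_iff.2 (Nat.one_le_iff_ne_zero.2 hmv)
      refine Ideal.mem_sup_right (Ideal.mem_span_singleton_mul.2
        ⟨monomial (m - Finsupp.single v 1) 1, monomial_mem_coverIdeal.2 ?_, ?_⟩)
      · rwa [isCover_filter_notMem one_ne_zero, tsub_add_cancel_of_le hle]
      · rw [X, monomial_mul, add_tsub_cancel_of_le hle, one_mul]
  · refine sup_le (Ideal.span_le.2 ?_) ?_
    · rintro _ ⟨y, hy, rfl⟩
      obtain ⟨hyv, hyB⟩ := Finset.mem_erase.1 (Finset.mem_coe.1 hy)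
      have h1 : (X y : MvPolynomial (Fin n) K) ∈ coverIdeal K (F.image (insert v)) := by
        rw [hB]
        exact X_mem_varIdeal.2 hyB
      exact monomial_mem_coverIdeal.2
        ((isCover_image_insert (by simp [hyv])).1 (monomial_mem_coverIdeal.1 h1))
    · rw [Ideal.span_singleton_mul_le_iff]
      intro f hf
      have := (mem_coverIdeal_filter_notMem one_ne_zero).1 hf
      rwa [pow_one, mul_comm] at this

end Regularity

/-! ### The equivalence and the splitting -/

theorem mainTheorem7 {K : Type*} [Field K] {n : ℕ} (I : Ideal (MvPolynomial (Fin n) K))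
    (hI0 : I ≠ ⊥) (hsq : IsSquarefreeMonomialIdeal I) (hdec : AssDecomposable I)
    (r : ℕ) (P : Fin r → Ideal (MvPolynomial (Fin n) K))
    (hP : IsMinimalPrimeDecomposition I P) :
    (HasRegularity n (quotientGrading I) ((r : ℤ) - 1) ↔ IsMaxGeneratorDegree I r) ∧
    ∀ v : Fin n, IsDecomposingVariable I v →
      HasRegularity n (quotientGrading I) ((r : ℤ) - 1) →
      ∃ p J : Ideal (MvPolynomial (Fin n) K),
        IsMonomialIdeal p ∧ p.IsPrime ∧ IsMonomialIdeal J ∧ AssDecomposable J ∧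
        I = p ⊔ Ideal.span {X v} * J := by
  obtain ⟨F, rfl, rfl, hanti⟩ :=
    exists_coverIdeal_of_isMinimalPrimeDecomposition hdec.isMonomialIdeal hP
  have hF : F.Nonempty := by
    rw [Finset.nonempty_iff_ne_empty]
    rintro rfl
    exact hdec.ne_top (by simp [coverIdeal])
  have h0 : ∅ ∉ F := fun h => hI0 (coverIdeal_eq_bot_of_empty_mem h)
  have hiff : HasRegularity n (quotientGrading (coverIdeal K F)) ((F.card : ℤ) - 1) ↔
      IsMaxGeneratorDegree (coverIdeal K F) F.card := by
    rw [hasRegularity_coverIdeal_iff hF, isMaxGeneratorDegree_iff]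
    constructor
    · rintro ⟨i, j, hij, hj⟩
      exact exists_minimal_of_not_torVanishes hdec rfl hanti h0 hij hj
    · rintro ⟨u, hu, hd⟩
      have hu0 : u ≠ 0 := by
        rintro rfl
        rw [map_zero] at hd
        exact hF.card_pos.ne hd
      exact ⟨1, u.degree, not_torVanishes_of_minimal hu hu0, by omega⟩
  refine ⟨hiff, fun v ⟨k, hv⟩ hreg => ?_⟩
  obtain ⟨u, hu, hd⟩ := isMaxGeneratorDegree_iff.1 (hiff.1 hreg)
  have hk : k ≠ 0 := hv.pos.ne'
  have hcov := isCover_image_insert_iff hk hv.ass_addPow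
  have hle := card_filter_mem_le_one hcov (filter_notMem_nonempty hv.notMem_radical) hu hd
  have hpos := (filter_mem_nonempty hcov hF).card_pos
  obtain ⟨B, hB⟩ := Finset.card_eq_one.1 (le_antisymm hle hpos)
  refine ⟨varIdeal K (B.erase v), colonPow (coverIdeal K F) v k, isMonomialIdeal_varIdeal _,
    varIdeal_isPrime _, hv.colonPow.isMonomialIdeal, hv.colonPow, coverIdeal_eq_sup hk ?_⟩
  rw [coverIdeal_image_insert_eq hk hv.ass_addPow, hB, coverIdeal_singleton]
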